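/- Let $(R,\mathfrak m)$ be a regular local ring of dimension two, let $I$ be an $\mathfrak m$-primary ideal, and let $$0\to R^{n-1}\xrightarrow{\ \varphi\ }R^n\to I\to 0\qquad(n\ge 2)$$ be a free resolution of $I$. For $1\le i\le n$ let $\Delta_i$ be the maximal minor of the $n\times(n-1)$ matrix $\varphi$ obtained by deleting its $i$-th row, and let $\varphi'$ be the $(n-2)\times(n-1)$ matrix consisting of the first $n-2$ rows of $\varphi$. Let $\delta_1,\dots,\delta_{n-1}$ be the maximal minors of $\varphi'$ ($\delta_j$ is obtained by deleting the $j$-th column; $\delta_1=1$ if $n=2$), and let $I_{n-2}(\varphi')$ be the ideal generated by the $(n-2)\times(n-2)$ minors of $\varphi'$. Suppose that $\Delta_{n-1},\Delta_n$ is a regular sequence, and put $J=(\Delta_{n-1},\Delta_n)$ and $E=(J:I)/J\subseteq R/J$. Then: 1. $J:I=I_{n-2}(\varphi')=(\delta_1,\dots,\delta_{n-1})$; in particular the classes of $\delta_1,\dots,\delta_{n-1}$ generate $E$. 2. If $e_1,\dots,e_{n-1}\in R$ are elements whose classes generate $E$ (for instance $e_i=\delta_i$), then for every $i$ such that the class of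 $e_i$ in $E$ is nonzero, the ideal $J:e_i$ is a complete intersection of codimension two, i.e. it has height two and is generated by a regular sequence of length two. 3. If the resolution is minimal (all entries of $\varphi$ lie in $\mathfrak m$), then for all $e_1,\dots,e_{n-1}\in R$ whose classes generate $E$, the class of every $e_i$ in $E$ is nonzero, and $J:I=(e_1,\dots,e_{n-1})$. -/

import Mathlib

/-- `determinantalIdeal t M` is `I_t(M)`, the ideal generated by all `t × t` minors of `M`. -/
def determinantalIdeal {R : Type*} [CommRing R] {m n : ℕ} (t : ℕ)
    (M : Matrix (Fin m) (Fin n) R) : Ideal R :=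
  Ideal.span {x : R | ∃ (r : Fin t ↪o Fin m) (c : Fin t ↪o Fin n), x = (M.submatrix r c).det}

/-- The `i`-th maximal minor `Δ_i` of an `(m + 1) × m` matrix: delete the `i`-th row. -/
def rowMinor {R : Type*} [CommRing R] {m : ℕ}
    (M : Matrix (Fin (m + 1)) (Fin m) R) (i : Fin (m + 1)) : R :=
  (M.submatrix i.succAbove id).det

/-- The `j`-th maximal minor of an `m × (m + 1)` matrix: delete the `j`-th column. -/
def colMinor {R : Type*} [CommRing R] {m : ℕ}
    (M : Matrix (Fin m) (Fin (m + 1)) R) (j : Fin (m + 1)) : R :=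
  (M.submatrix id j.succAbove).det

/-- The matrix `φ'` obtained from `φ` by deleting its last two rows. -/
def deleteLastTwoRows {R : Type*} {k l : ℕ}
    (M : Matrix (Fin (k + 2)) (Fin l) R) : Matrix (Fin k) (Fin l) R :=
  M.submatrix (Fin.castAdd 2) id

/-- `0 → R^{n-1} → R^n → I → 0` is a free resolution of the ideal `I`, where the first map is
given by the matrix `φ` and the second one is `π`. -/
structure IsFreeResolution {R : Type*} [CommRing R] {m : ℕ} (I : Ideal R)
    (φ : Matrix (Fin (m + 1)) (Fin m) R) (π : (Fin (m + 1) → R) →ₗ[R] I) : Prop where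
  injective : Function.Injective φ.mulVecLin
  exact : Function.Exact φ.mulVecLin π
  surjective : Function.Surjective π

/-- `E = (J : I) / J`, as an ideal of `R / J` (here `J ⊆ J : I` always holds). -/
def colonModulo {R : Type*} [CommRing R] (J I : Ideal R) : Ideal (R ⧸ J) :=
  (J.colon (I : Set R)).map (Ideal.Quotient.mk J)

/-- The ideal `K` has codimension (height) `c` and is generated by a regular sequence of
length `c`. -/
def IsCompleteIntersectionOfCodim {R : Type*} [CommRing R] (K : Ideal R) (c : ℕ) : Prop :=
  K.height = c ∧
    ∃ rs : List R, rs.length = c ∧ RingTheory.Sequence.IsRegular R rs ∧ K = Ideal.ofList rs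

/-!
The argument uses one principle over a domain: if `a, b` is a regular sequence and `a, b` lie in the
ideal generated by the entries of a vector `d`, then every vector proportional to `d` is a multiple
of `d` (`exists_eq_smul_of_proportional`). It gives both halves of the Hilbert–Burch theorem for an
`m × (m + 1)` matrix `M` whose maximal minors generate an ideal containing a regular sequence of
length two: with `δ` the vector of signed maximal minors, the kernel of `M` is `R δ`
(`exists_eq_smul_signedColMinor`), and the syzygies of `δ` are the combinations of the rows of `M`
(`exists_eq_vecMul_of_dotProduct_eq_zero`).

Applied to the transpose of `φ`, this shows that `I` is generated by the maximal minors of `φ`, up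
to a factor which is a unit by Krull's principal ideal theorem. Hence `I / J` is the cokernel
of `φ'`, and `J : I` is its annihilator. The minors `δ_j` annihilate the cokernel, by Cramer's rule.
Conversely, if `x` annihilates it, write `x = φ' B`; the columns of `x - B φ'` lie in the kernel
of `φ'`, so `x - B φ' = δ tᵀ`, and evaluating at `δ` gives `x = tᵀ δ`
(`exists_eq_dotProduct_signedColMinor`).

For `e ∉ J`, the elements of `J : e` are the last coordinates of the syzygies of `a, b, e`. The
maximal ideal contains some `x ≠ 0` such that `R / x` is a principal ideal domain; modulo `x` the
syzygies form a submodule of the kernel of a nonzero functional on `(R / x) ^ 3`, which has rank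
two, so by Nakayama's lemma two syzygies suffice (`exists_span_pair_eq_ker`). The two resulting
generators of `J : e` form a regular sequence, again by the principle above.

If the entries of `φ` lie in the maximal ideal `𝔪`, expanding `Δ_{n-1}` and `Δ_n` along their last
rows shows `J ⊆ 𝔪 (J : I)`, so generators of `E` lift to generators of `J : I` by Nakayama's lemma.
None of them can be zero in `E`: the syzygies of `δ` have coefficients in `𝔪`, so that `J : I`
needs `n - 1` generators.
-/

/-! ### Regular pairs in a domain -/

section RegularPair

variable {R : Type*} [CommRing R] [IsDomain R] {a b : R}

open RingTheory.Sequence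

theorem isWeaklyRegular_pair_iff :
    IsWeaklyRegular R [a, b] ↔ a ≠ 0 ∧ ∀ z w, b * z = a * w → a ∣ z := by
  rw [isWeaklyRegular_cons_iff, isWeaklyRegular_singleton_iff]
  refine and_congr ⟨?_, ?_⟩ ?_
  · rintro h rfl
    exact one_ne_zero (h (by simp : (0 : R) • (1 : R) = (0 : R) • 0))
  · intro h x y hxy
    exact mul_left_cancel₀ h hxy
  · have key : ∀ z : R, (Submodule.Quotient.mk z : QuotSMulTop a R) = 0 ↔ a ∣ z := by
      intro z
      rw [Submodule.Quotient.mk_eq_zero, Submodule.mem_smul_pointwise_iff_exists]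
      constructor
      · rintro ⟨w, -, rfl⟩
        exact ⟨w, rfl⟩
      · rintro ⟨w, rfl⟩
        exact ⟨w, trivial, rfl⟩
    rw [isSMulRegular_iff_right_eq_zero_of_smul]
    constructor
    · intro h z w hzw
      refine (key z).1 (h _ ?_)
      rw [← Submodule.Quotient.mk_smul, key]
      exact ⟨w, hzw⟩
    · intro h z hz
      obtain ⟨z, rfl⟩ := Submodule.Quotient.mk_surjective _ z
      rw [← Submodule.Quotient.mk_smul, key] at hz
      obtain ⟨w, hw⟩ := hz
      exact (key z).2 (h z w hw)

theorem exists_eq_smul_of_smul_eq {ι : Type*} (h : IsWeaklyRegular R [a, b]) {s t : ι → R}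
    (e : b • s = a • t) : ∃ s', s = a • s' := by
  choose s' hs' using fun i => (isWeaklyRegular_pair_iff.1 h).2 (s i) (t i) (congrFun e i)
  exact ⟨s', funext hs'⟩

/-- A vector proportional to `d` is a multiple of `d` as soon as the entries of `d` generate an
ideal containing a regular sequence of length two. -/
theorem exists_eq_smul_of_proportional {ι : Type*} [Fintype ι] (h : IsWeaklyRegular R [a, b])
    {d v r r' : ι → R} (ha : a = r ⬝ᵥ d) (hb : b = r' ⬝ᵥ d)
    (hv : ∀ ρ, (ρ ⬝ᵥ d) • v = (ρ ⬝ᵥ v) • d) : ∃ t : R, v = t • d := by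
  obtain ⟨ha0, hdvd⟩ := isWeaklyRegular_pair_iff.1 h
  have h1 := hv r
  have h2 := hv r'
  rw [← ha] at h1
  rw [← hb] at h2
  have h3 : b * (r ⬝ᵥ v) = a * (r' ⬝ᵥ v) := by
    have := congrArg (fun w => r ⬝ᵥ w) h2
    simp only [dotProduct_smul, smul_eq_mul, ← ha] at this
    rw [this, mul_comm]
  obtain ⟨t, ht⟩ := hdvd _ _ h3
  refine ⟨t, ?_⟩
  rw [ht, mul_smul] at h1
  exact smul_right_injective _ ha0 h1

/-- Two elements of a domain whose ideal contains a regular sequence of length two form a regular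
sequence themselves, provided the first one is nonzero. -/
theorem isWeaklyRegular_pair_of_mem_span {c d : R} (h : IsWeaklyRegular R [a, b]) (hc : c ≠ 0)
    (ha : a ∈ Ideal.span {c, d}) (hb : b ∈ Ideal.span {c, d}) : IsWeaklyRegular R [c, d] := by
  refine isWeaklyRegular_pair_iff.2 ⟨hc, fun z w hzw => ?_⟩
  obtain ⟨α, β, hαβ⟩ := Ideal.mem_span_pair.1 ha
  obtain ⟨γ, δ, hγδ⟩ := Ideal.mem_span_pair.1 hb
  -- `d * z = c * w` says that `(z, w)` is proportional to `(c, d)`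
  have hdot : ∀ (ρ : Fin 2 → R) (p q : R), ρ ⬝ᵥ ![p, q] = ρ 0 * p + ρ 1 * q := fun ρ p q =>
    Fin.sum_univ_two _
  obtain ⟨t, ht⟩ := exists_eq_smul_of_proportional (d := ![c, d]) (v := ![z, w]) (r := ![α, β])
    (r' := ![γ, δ]) h ((hdot _ _ _).trans hαβ).symm ((hdot _ _ _).trans hγδ).symm (by
      intro ρ
      rw [hdot, hdot]
      refine funext (Fin.forall_fin_two.2 ⟨?_, ?_⟩)
      · change (ρ 0 * c + ρ 1 * d) * z = (ρ 0 * z + ρ 1 * w) * c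
        linear_combination (ρ 1) * hzw
      · change (ρ 0 * c + ρ 1 * d) * w = (ρ 0 * z + ρ 1 * w) * d
        linear_combination (-ρ 0) * hzw)
  exact ⟨t, (congrFun ht 0).trans (mul_comm t c)⟩

end RegularPair

/-! ### The maximal minors of an `m × (m + 1)` matrix -/

section Minors

open Matrix

variable {R : Type*} [CommRing R] {m : ℕ}

/-- The maximal minors of an `m × (m + 1)` matrix, with the signs that turn them into an element
of the kernel. -/
def signedColMinor (M : Matrix (Fin m) (Fin (m + 1)) R) (j : Fin (m + 1)) : R :=
  (-1) ^ (j : ℕ) * colMinor M j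

theorem mem_span_range_colMinor_iff {M : Matrix (Fin m) (Fin (m + 1)) R} {x : R} :
    x ∈ Ideal.span (Set.range (colMinor M)) ↔ ∃ r, x = r ⬝ᵥ signedColMinor M := by
  have hsq : ∀ j : Fin (m + 1), ((-1 : R) ^ (j : ℕ)) * (-1) ^ (j : ℕ) = 1 := fun j => by
    rw [← mul_pow]; simp
  rw [Ideal.mem_span_range_iff_exists_fun]
  constructor
  · rintro ⟨c, rfl⟩
    refine ⟨fun j => (-1) ^ (j : ℕ) * c j, Finset.sum_congr rfl fun j _ => ?_⟩
    rw [signedColMinor]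
    linear_combination (-c j * colMinor M j) * hsq j
  · rintro ⟨r, rfl⟩
    refine ⟨fun j => (-1) ^ (j : ℕ) * r j, Finset.sum_congr rfl fun j _ => ?_⟩
    rw [signedColMinor]
    ring

theorem determinantalIdeal_eq_span_range_colMinor (M : Matrix (Fin m) (Fin (m + 1)) R) :
    determinantalIdeal m M = Ideal.span (Set.range (colMinor M)) := by
  unfold determinantalIdeal
  congr 1
  ext x
  simp only [Set.mem_ofPred_eq, Set.mem_range, colMinor]
  constructor
  · rintro ⟨r, c, rfl⟩
    have hr : (r : Fin m → Fin m) = id := by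
      rw [(OrderEmbedding.range_inj (f := r) (g := (OrderIso.refl _).toOrderEmbedding)).1]
      · rfl
      · rw [(Finite.injective_iff_surjective.1 r.injective).range_eq]
        exact (OrderIso.refl (Fin m)).surjective.range_eq.symm
    obtain ⟨j, hj⟩ : ∃ j, j ∉ Set.range c := by
      by_contra! hall
      have := Fintype.card_le_of_surjective c hall
      simp at this
    have hc : c = j.succAboveOrderEmb := by
      rw [← OrderEmbedding.range_inj, Fin.range_succAboveOrderEmb]
      refine Set.eq_of_subset_of_ncard_le (fun x hx => fun hxj => hj (hxj ▸ hx)) ?_ (Set.toFinite _)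
      rw [Set.ncard_range_of_injective c.injective, Set.ncard_compl]
      simp
    exact ⟨j, by rw [hr, hc]; rfl⟩
  · rintro ⟨j, rfl⟩
    exact ⟨(OrderIso.refl _).toOrderEmbedding, j.succAboveOrderEmb, rfl⟩

/-- The square matrix obtained by putting the row `r` on top of `M`. -/
def consRow (r : Fin (m + 1) → R) (M : Matrix (Fin m) (Fin (m + 1)) R) :
    Matrix (Fin (m + 1)) (Fin (m + 1)) R :=
  Matrix.of (vecCons r M)

theorem consRow_submatrix (r : Fin (m + 1) → R) (M : Matrix (Fin m) (Fin (m + 1)) R)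
    (j : Fin (m + 1)) :
    ((consRow r M).submatrix (Fin.succAbove 0) j.succAbove).det = colMinor M j := by
  simp only [colMinor]
  congr 1

theorem det_consRow (r : Fin (m + 1) → R) (M : Matrix (Fin m) (Fin (m + 1)) R) :
    (consRow r M).det = r ⬝ᵥ signedColMinor M := by
  rw [det_succ_row _ 0]
  refine Finset.sum_congr rfl fun j _ => ?_
  rw [consRow_submatrix, signedColMinor, Fin.val_zero, zero_add]
  change (-1) ^ (j : ℕ) * r j * _ = _
  ring

theorem adjugate_consRow_apply_zero (r : Fin (m + 1) → R) (M : Matrix (Fin m) (Fin (m + 1)) R)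
    (j : Fin (m + 1)) : (consRow r M).adjugate j 0 = signedColMinor M j := by
  rw [adjugate_fin_succ_eq_det_submatrix, consRow_submatrix, signedColMinor]
  simp

theorem mulVec_consRow (r : Fin (m + 1) → R) (M : Matrix (Fin m) (Fin (m + 1)) R)
    (v : Fin (m + 1) → R) : consRow r M *ᵥ v = vecCons (r ⬝ᵥ v) (M *ᵥ v) :=
  cons_mulVec r M v

theorem vecMul_consRow (r : Fin (m + 1) → R) (M : Matrix (Fin m) (Fin (m + 1)) R)
    (v : Fin (m + 1) → R) : v ᵥ* consRow r M = v 0 • r + Fin.tail v ᵥ* M :=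
  vecMul_cons v r M

theorem mulVec_signedColMinor (M : Matrix (Fin m) (Fin (m + 1)) R) :
    M *ᵥ signedColMinor M = 0 := by
  ext i
  -- the `i`-th entry is the determinant of `M` with its `i`-th row repeated on top
  have h := det_consRow (M i) M
  rw [det_zero_of_row_eq (Fin.succ_ne_zero i).symm rfl] at h
  exact h.symm

/-- A vector in the kernel of `M` is proportional to the vector of signed maximal minors, by Cramer's
rule for `M` completed to a square matrix by a row `r`. -/
theorem smul_eq_smul_signedColMinor {M : Matrix (Fin m) (Fin (m + 1)) R} {v : Fin (m + 1) → R}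
    (hv : M *ᵥ v = 0) (r : Fin (m + 1) → R) :
    (r ⬝ᵥ signedColMinor M) • v = (r ⬝ᵥ v) • signedColMinor M := by
  have h : (consRow r M).adjugate *ᵥ (consRow r M *ᵥ v) = (r ⬝ᵥ signedColMinor M) • v := by
    rw [mulVec_mulVec, adjugate_mul, det_consRow, smul_mulVec, one_mulVec]
  rw [← h, mulVec_consRow, hv]
  ext j
  simp [mulVec, dotProduct, Fin.sum_univ_succ, adjugate_consRow_apply_zero, mul_comm]

/-- Cramer's rule for `M` completed by a row `r`: it writes a multiple of `c` as a combination of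
`r` and the rows of `M`, and the coefficient of `r` vanishes if `c` is a syzygy of the minors. -/
theorem exists_smul_eq_add_vecMul (M : Matrix (Fin m) (Fin (m + 1)) R) (r c : Fin (m + 1) → R) :
    ∃ s, (r ⬝ᵥ signedColMinor M) • c = (c ⬝ᵥ signedColMinor M) • r + s ᵥ* M := by
  refine ⟨Fin.tail (c ᵥ* (consRow r M).adjugate), ?_⟩
  have h : (c ᵥ* (consRow r M).adjugate) ᵥ* consRow r M = (r ⬝ᵥ signedColMinor M) • c := by
    rw [vecMul_vecMul, adjugate_mul, det_consRow, vecMul_smul, vecMul_one]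
  rw [← h, vecMul_consRow]
  congr 2
  simp only [vecMul, dotProduct, adjugate_consRow_apply_zero]

/-- The maximal minors of `M` annihilate its cokernel. -/
theorem exists_mulVec_eq_smul (M : Matrix (Fin m) (Fin (m + 1)) R) (r : Fin (m + 1) → R)
    (w : Fin m → R) : ∃ u, M *ᵥ u = (r ⬝ᵥ signedColMinor M) • w := by
  refine ⟨(consRow r M).adjugate *ᵥ vecCons 0 w, ?_⟩
  have h : consRow r M *ᵥ ((consRow r M).adjugate *ᵥ vecCons 0 w) =
      (r ⬝ᵥ signedColMinor M) • vecCons 0 w := by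
    rw [mulVec_mulVec, mul_adjugate, det_consRow, smul_mulVec, one_mulVec]
  rw [mulVec_consRow] at h
  ext i
  simpa using congrFun h i.succ

end Minors

section HilbertBurch

open Matrix RingTheory.Sequence

variable {R : Type*} [CommRing R] [IsDomain R] {m : ℕ} {a b : R}
  {M : Matrix (Fin m) (Fin (m + 1)) R} {r r' : Fin (m + 1) → R}

/-- If the maximal minors of `M` generate an ideal containing a regular sequence of length two,
then the kernel of `M` is generated by the vector of signed maximal minors. -/
theorem exists_eq_smul_signedColMinor (h : IsWeaklyRegular R [a, b])
    (ha : a = r ⬝ᵥ signedColMinor M) (hb : b = r' ⬝ᵥ signedColMinor M) {v : Fin (m + 1) → R}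
    (hv : M *ᵥ v = 0) : ∃ t : R, v = t • signedColMinor M :=
  exists_eq_smul_of_proportional h ha hb (smul_eq_smul_signedColMinor hv)

/-- If the maximal minors of `M` generate an ideal containing a regular sequence of length two,
then their syzygies are generated by the rows of `M`. -/
theorem exists_eq_vecMul_of_dotProduct_eq_zero (h : IsWeaklyRegular R [a, b])
    (ha : a = r ⬝ᵥ signedColMinor M) (hb : b = r' ⬝ᵥ signedColMinor M) {c : Fin (m + 1) → R}
    (hc : c ⬝ᵥ signedColMinor M = 0) : ∃ s, c = s ᵥ* M := by
  obtain ⟨ha0, -⟩ := isWeaklyRegular_pair_iff.1 h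
  obtain ⟨s, hs⟩ := exists_smul_eq_add_vecMul M r c
  obtain ⟨t, ht⟩ := exists_smul_eq_add_vecMul M r' c
  rw [hc, zero_smul, zero_add, ← ha] at hs
  rw [hc, zero_smul, zero_add, ← hb] at ht
  -- the rows of `M` are linearly independent, as `M` is part of a matrix with determinant `a ≠ 0`
  have hinj : ∀ u : Fin m → R, u ᵥ* M = 0 → u = 0 := by
    intro u hu
    have h0 : vecCons 0 u ᵥ* consRow r M = 0 := by
      rw [vecMul_consRow]
      simpa using hu
    have := eq_zero_of_vecMul_eq_zero (by rwa [det_consRow, ← ha]) h0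
    ext i
    simpa using congrFun this i.succ
  have hst : b • s = a • t := by
    rw [← sub_eq_zero]
    refine hinj _ ?_
    rw [sub_vecMul, smul_vecMul, smul_vecMul, ← hs, ← ht, smul_comm, sub_self]
  obtain ⟨s', rfl⟩ := exists_eq_smul_of_smul_eq h hst
  refine ⟨s', smul_right_injective _ ha0 ?_⟩
  change a • c = a • _
  rw [hs, smul_vecMul]

/-- The annihilator of the cokernel of `M` consists of combinations of the maximal minors: if
`x = M B`, then `x - B M` maps to the kernel of `M`, so `x - B M = δ tᵀ` with `δ` the vector of
signed minors, and applying both sides to `δ` gives `x = tᵀ δ`. -/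
theorem exists_eq_dotProduct_signedColMinor (h : IsWeaklyRegular R [a, b])
    (ha : a = r ⬝ᵥ signedColMinor M) (hb : b = r' ⬝ᵥ signedColMinor M) {x : R}
    {B : Matrix (Fin (m + 1)) (Fin m) R} (hB : M * B = x • (1 : Matrix (Fin m) (Fin m) R)) :
    ∃ t, x = t ⬝ᵥ signedColMinor M := by
  obtain ⟨ha0, -⟩ := isWeaklyRegular_pair_iff.1 h
  have hker : ∀ v, M *ᵥ (x • v - B *ᵥ (M *ᵥ v)) = 0 := by
    intro v
    rw [mulVec_sub, mulVec_mulVec, hB, mulVec_smul, smul_mulVec, one_mulVec, sub_self]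
  choose t ht using fun j => exists_eq_smul_signedColMinor h ha hb (hker (Pi.single j 1))
  have hlin : ∀ v, x • v - B *ᵥ (M *ᵥ v) = (t ⬝ᵥ v) • signedColMinor M := by
    intro v
    have hmat : x • (1 : Matrix (Fin (m + 1)) (Fin (m + 1)) R) - B * M =
        vecMulVec (signedColMinor M) t := by
      ext i j
      have := congrFun (ht j) i
      rw [mulVec_mulVec] at this
      simp only [mulVec_single_one, Pi.sub_apply, Pi.smul_apply, smul_eq_mul, col_apply] at this
      simp only [Matrix.sub_apply, Matrix.smul_apply, smul_eq_mul, vecMulVec_apply, one_apply]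
      rw [Pi.single_apply] at this
      rw [this, mul_comm]
    calc x • v - B *ᵥ (M *ᵥ v) = (x • (1 : Matrix (Fin (m + 1)) (Fin (m + 1)) R) - B * M) *ᵥ v := by
          rw [sub_mulVec, smul_mulVec, one_mulVec, mulVec_mulVec]
      _ = _ := by
          rw [hmat, vecMulVec_mulVec]
          ext i
          simp [mul_comm]
  refine ⟨t, ?_⟩
  have hδ := hlin (signedColMinor M)
  rw [mulVec_signedColMinor, mulVec_zero, sub_zero] at hδ
  have := congrArg (fun w => r ⬝ᵥ w) hδ
  simp only [dotProduct_smul, smul_eq_mul, ← ha] at this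
  exact mul_right_cancel₀ ha0 this

end HilbertBurch

/-! ### Regular local rings of dimension two -/

section RegularLocalRing

open IsLocalRing

variable {R : Type*} [CommRing R]

/-- A prime ideal `P` that does not contain `y`, but is contained in `(y)`, satisfies `P = y P`,
so it vanishes by Nakayama's lemma. -/
theorem Ideal.IsPrime.eq_bot_of_le_span_singleton [IsLocalRing R] [IsNoetherianRing R] {y : R}
    (hy : y ∈ maximalIdeal R) {P : Ideal R} (hP : P.IsPrime) (hle : P ≤ Ideal.span {y})
    (hyP : y ∉ P) : P = ⊥ := by
  refine Submodule.eq_bot_of_le_smul_of_le_jacobson_bot (maximalIdeal R) P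
    (IsNoetherian.noetherian P) (fun p hp => ?_) (maximalIdeal_le_jacobson _)
  obtain ⟨q, rfl⟩ := Ideal.mem_span_singleton.1 (hle hp)
  exact Submodule.smul_mem_smul hy ((hP.mem_or_mem hp).resolve_left hyP)

/-- A Noetherian local ring of positive dimension whose maximal ideal is principal is a domain. -/
theorem isDomain_of_maximalIdeal_eq_span_singleton [IsLocalRing R] [IsNoetherianRing R] {y : R}
    (hy : maximalIdeal R = Ideal.span {y}) (hdim : 0 < ringKrullDim R) : IsDomain R := by
  have : ¬ (maximalIdeal R) ∈ minimalPrimes R := by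
    intro hmin
    rw [← maximalIdeal_height_eq_ringKrullDim] at hdim
    rw [Ideal.height_eq_zero_iff.2 hmin] at hdim
    exact lt_irrefl _ hdim
  obtain ⟨P, hPmin, hPle⟩ := Ideal.exists_minimalPrimes_le (bot_le : ⊥ ≤ maximalIdeal R)
  have hP : P.IsPrime := hPmin.1.1
  have hyP : y ∉ P := by
    intro h
    refine this ?_
    have : P = maximalIdeal R := le_antisymm hPle (by rw [hy]; simpa [Ideal.span_le] using h)
    rwa [← this]
  have hbot := hP.eq_bot_of_le_span_singleton (hy ▸ Ideal.mem_span_singleton_self y)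
    (hPle.trans hy.le) hyP
  rw [hbot] at hP
  exact IsDomain.of_bot_isPrime R

theorem isDomain_quotient_and_isPrincipalIdealRing_of_maximalIdeal_eq_span_pair [IsLocalRing R]
    [IsNoetherianRing R] (hdim : ringKrullDim R = 2) {x y : R}
    (hxy : maximalIdeal R = Ideal.span {x, y}) :
    IsDomain (R ⧸ Ideal.span {x}) ∧ IsPrincipalIdealRing (R ⧸ Ideal.span {x}) := by
  have hx : x ∈ maximalIdeal R := hxy ▸ Ideal.subset_span (by simp)
  have hne : Ideal.span {x} ≠ ⊤ := by
    rwa [Ne, Ideal.span_singleton_eq_top]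
  have : Nontrivial (R ⧸ Ideal.span {x}) := Ideal.Quotient.nontrivial_iff.2 hne
  have hloc : IsLocalRing (R ⧸ Ideal.span {x}) :=
    IsLocalRing.of_surjective' _ Ideal.Quotient.mk_surjective
  have hmax : maximalIdeal (R ⧸ Ideal.span {x}) =
      Ideal.span {Ideal.Quotient.mk (Ideal.span {x}) y} := by
    have := IsLocalRing.map_maximalIdeal_of_surjective _
      (Ideal.Quotient.mk_surjective (I := Ideal.span {x}))
    rw [← this, hxy, Ideal.map_span, Set.image_pair,
      Ideal.Quotient.eq_zero_iff_mem.2 (Ideal.mem_span_singleton_self x)]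
    exact Ideal.span_insert_zero
  have hpos : 0 < ringKrullDim (R ⧸ Ideal.span {x}) := by
    have h := Ideal.height_le_ringKrullDim_quotient_add_one hx
    rw [maximalIdeal_height_eq_ringKrullDim, hdim] at h
    by_contra hcon
    rw [not_lt] at hcon
    have h2 : (2 : WithBot ℕ∞) ≤ 0 + 1 := h.trans (by gcongr)
    exact absurd h2 (by decide)
  have hdom := isDomain_of_maximalIdeal_eq_span_singleton hmax hpos
  exact ⟨hdom, ((tfae_of_isNoetherianRing_of_isLocalRing_of_isDomain
    (R ⧸ Ideal.span {x})).out 0 4).2 (⟨⟨_, hmax⟩⟩ : (maximalIdeal (R ⧸ Ideal.span {x})).IsPrincipal)⟩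

/-- A regular local ring `R` of dimension two is a domain, and it has a parameter `x` such that
`R / x` is a principal ideal domain. -/
theorem IsRegularLocalRing.exists_isPrincipalIdealRing_quotient [IsRegularLocalRing R]
    (hdim : ringKrullDim R = 2) : IsDomain R ∧ ∃ x ∈ maximalIdeal R,
      x ≠ 0 ∧ IsDomain (R ⧸ Ideal.span {x}) ∧ IsPrincipalIdealRing (R ⧸ Ideal.span {x}) := by
  obtain ⟨x, y, hxy⟩ : ∃ x y, maximalIdeal R = Ideal.span {x, y} := by
    have hrank := IsRegularLocalRing.spanFinrank_maximalIdeal (R := R)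
    rw [hdim] at hrank
    have hrank' : (maximalIdeal R).spanFinrank = 2 := by exact_mod_cast hrank
    have hfg := (maximalIdeal R).fg_of_isNoetherianRing
    rw [← Submodule.FG.generators_ncard hfg, Set.ncard_eq_two] at hrank'
    obtain ⟨x, y, -, hgen⟩ := hrank'
    exact ⟨x, y, by rw [← hgen]; exact ((maximalIdeal R).span_generators).symm⟩
  have hx : x ∈ maximalIdeal R := hxy ▸ Ideal.subset_span (by simp)
  have hy : y ∈ maximalIdeal R := hxy ▸ Ideal.subset_span (by simp)
  -- every `x + y ^ (n + 1)` is also part of a system of two generators of the maximal ideal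
  have hpair : ∀ n : ℕ, maximalIdeal R = Ideal.span {x + y ^ (n + 1), y} := by
    intro n
    rw [hxy]
    rw [pow_succ, Ideal.span_pair_add_mul_right]
  have hmem : ∀ n : ℕ, x + y ^ (n + 1) ∈ maximalIdeal R := fun n =>
    add_mem hx (Ideal.pow_mem_of_mem _ hy _ n.succ_pos)
  have hquot := fun n =>
    isDomain_quotient_and_isPrincipalIdealRing_of_maximalIdeal_eq_span_pair hdim (hpair n)
  have hprime : ∀ n : ℕ, (Ideal.span {x + y ^ (n + 1)}).IsPrime := fun n =>
    (Ideal.Quotient.isDomain_iff_prime _).1 (hquot n).1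
  -- these elements generate pairwise distinct primes, so one of the primes is not minimal
  obtain ⟨n, hn⟩ : ∃ n : ℕ, Ideal.span {x + y ^ (n + 1)} ∉ minimalPrimes R := by
    by_contra! hall
    have hfin : Finite (minimalPrimes R) := minimalPrimes.finite_of_isNoetherianRing R
    obtain ⟨i, j, hij, heq⟩ := Finite.exists_ne_map_eq_of_infinite
      (fun n : ℕ => (⟨_, hall n⟩ : minimalPrimes R))
    rw [Subtype.mk.injEq] at heq
    wlog hlt : i < j generalizing i j
    · exact this j i hij.symm heq.symm (lt_of_le_of_ne (not_lt.1 hlt) hij.symm)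
    have hP := hprime i
    set P := Ideal.span {x + y ^ (i + 1)} with hPdef
    have h1 : x + y ^ (i + 1) ∈ P := Ideal.mem_span_singleton_self _
    have h2 : x + y ^ (j + 1) ∈ P := heq ▸ Ideal.mem_span_singleton_self _
    obtain ⟨d, rfl⟩ := Nat.exists_eq_add_of_lt hlt
    have h3 : y ^ (i + 1) * (1 - y ^ (d + 1)) ∈ P := by
      have := P.sub_mem h1 h2
      convert this using 1
      ring
    have hunit : IsUnit (1 - y ^ (d + 1)) :=
      IsLocalRing.isUnit_one_sub_self_of_mem_nonunits _
        (Ideal.pow_mem_of_mem _ hy _ d.succ_pos)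
    have hyi : y ^ (i + 1) ∈ P := (Ideal.mul_unit_mem_iff_mem P hunit).1 h3
    have hyP : y ∈ P := hP.mem_of_pow_mem _ hyi
    have hPm : P = maximalIdeal R := by
      refine le_antisymm (le_maximalIdeal hP.ne_top) ?_
      rw [hpair i, Ideal.span_le]
      rintro z (rfl | rfl)
      exacts [h1, hyP]
    have hmin := hall i
    rw [← hPdef, hPm] at hmin
    have := maximalIdeal_height_eq_ringKrullDim (R := R)
    rw [Ideal.height_eq_zero_iff.2 hmin, hdim] at this
    exact absurd this (by decide)
  refine ⟨?_, _, hmem n, fun h0 => ?_, hquot n⟩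
  swap
  · -- the maximal ideal would be principal, hence of height at most one
    have hm := hpair n
    rw [h0, Ideal.span_insert_zero] at hm
    have h1 := Ideal.height_span_singleton_le_one (x := y) hy
    rw [← hm] at h1
    have h2 := maximalIdeal_height_eq_ringKrullDim (R := R)
    rw [hdim] at h2
    have h3 : (maximalIdeal R).height = 2 := WithBot.coe_injective h2
    rw [h3] at h1
    exact absurd h1 (by decide)
  have := hprime n
  obtain ⟨Q, hQmin, hQle⟩ :=
    Ideal.exists_minimalPrimes_le (bot_le : ⊥ ≤ Ideal.span {x + y ^ (n + 1)})
  have hQ : Q.IsPrime := hQmin.1.1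
  have hbot := hQ.eq_bot_of_le_span_singleton (hmem n) hQle (fun hcon => hn (by
    rwa [show Ideal.span {x + y ^ (n + 1)} = Q from
      le_antisymm (by simpa [Ideal.span_le] using hcon) hQle]))
  rw [hbot] at hQ
  exact IsDomain.of_bot_isPrime R

end RegularLocalRing

/-! ### Colon ideals of regular sequences in dimension two -/

section ColonSingleton

open IsLocalRing

/-- A submodule of the kernel of a nonzero linear functional on `D ^ 3`, for a principal ideal
domain `D`, is generated by two elements. -/
theorem exists_span_pair_eq_of_le_ker {D : Type*} [CommRing D] [IsDomain D] [IsPrincipalIdealRing D]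
    (f : (Fin 3 → D) →ₗ[D] D) (hf : f ≠ 0) (T : Submodule D (Fin 3 → D))
    (hT : T ≤ LinearMap.ker f) : ∃ s t, Submodule.span D {s, t} = T := by
  have hrange : 0 < Module.finrank D (LinearMap.range f) := by
    rw [Module.finrank_pos_iff, Submodule.nontrivial_iff_ne_bot, Ne, LinearMap.range_eq_bot]
    exact hf
  have hsum := (LinearMap.ker f).finrank_quotient_add_finrank
  rw [f.quotKerEquivRange.finrank_eq, Module.finrank_fin_fun] at hsum
  have hle : Module.finrank D T ≤ 2 := (Submodule.finrank_mono hT).trans (by omega)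
  have hbasis := (Module.finBasis D T).span_eq
  let g : Fin 2 → T := fun i =>
    if h : (i : ℕ) < Module.finrank D T then Module.finBasis D T ⟨i, h⟩ else 0
  refine ⟨g 0, g 1, le_antisymm ?_ ?_⟩
  · rw [Submodule.span_le]
    rintro z (rfl | rfl)
    exacts [(g 0).2, (g 1).2]
  · have hg : ∀ i, Module.finBasis D T i ∈ Submodule.span D {g 0, g 1} := by
      intro i
      have hi : Module.finBasis D T i = g ⟨i, i.2.trans_le hle⟩ := by simp [g]
      rw [hi]
      refine Submodule.subset_span ?_
      generalize (⟨i, i.2.trans_le hle⟩ : Fin 2) = l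
      fin_cases l <;> simp
    have htop : (⊤ : Submodule D T) ≤ Submodule.span D {g 0, g 1} := by
      rw [← hbasis, Submodule.span_le]
      rintro _ ⟨i, rfl⟩
      exact hg i
    have := Submodule.map_mono (f := T.subtype) htop
    rwa [Submodule.map_subtype_top, Submodule.map_span, Set.image_pair] at this

/-- If `R / x` is a principal ideal domain for some `x` in the maximal ideal of the Noetherian
local domain `R`, then the syzygies of three elements that are not all divisible by `x` are
generated by two elements. Indeed, modulo `x` the syzygy module embeds into the kernel of a nonzero
functional on `(R / x) ^ 3`, and Nakayama's lemma applies. -/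
theorem exists_span_pair_eq_ker {R : Type*} [CommRing R] [IsDomain R] [IsLocalRing R]
    [IsNoetherianRing R] {x : R} (hx : x ∈ maximalIdeal R) (hx0 : x ≠ 0)
    [IsDomain (R ⧸ Ideal.span {x})] [IsPrincipalIdealRing (R ⧸ Ideal.span {x})]
    (c : Fin 3 → R) (hc : ∃ i, ¬ x ∣ c i) :
    ∃ s t, s ⬝ᵥ c = 0 ∧ t ⬝ᵥ c = 0 ∧ ∀ v : Fin 3 → R, v ⬝ᵥ c = 0 → ∃ α β : R, v = α • s + β • t := by
  let D := R ⧸ Ideal.span {x}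
  let q : R →+* D := Ideal.Quotient.mk _
  have hq : ∀ z, q z = 0 ↔ x ∣ z := fun z => by
    rw [Ideal.Quotient.eq_zero_iff_mem, Ideal.mem_span_singleton]
  let S : Submodule R (Fin 3 → R) := LinearMap.ker (Fintype.linearCombination R c)
  have hS : ∀ v, v ∈ S ↔ v ⬝ᵥ c = 0 := fun v => by
    simp [S, Fintype.linearCombination_apply, dotProduct]
  let f : (Fin 3 → D) →ₗ[D] D := Fintype.linearCombination D (fun i => q (c i))
  have hfapp : ∀ v : Fin 3 → R, f (q ∘ v) = q (v ⬝ᵥ c) := fun v => by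
    simp [f, Fintype.linearCombination_apply, dotProduct]
  let T : Submodule D (Fin 3 → D) :=
    { carrier := {w | ∃ v ∈ S, q ∘ v = w}
      zero_mem' := ⟨0, S.zero_mem, by ext; simp⟩
      add_mem' := by
        rintro _ _ ⟨v, hv, rfl⟩ ⟨w, hw, rfl⟩
        exact ⟨v + w, S.add_mem hv hw, by ext; simp⟩
      smul_mem' := by
        rintro r _ ⟨v, hv, rfl⟩
        obtain ⟨r, rfl⟩ := Ideal.Quotient.mk_surjective r
        exact ⟨r • v, S.smul_mem r hv, by ext; simp [q]⟩ }
  have hf : f ≠ 0 := by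
    obtain ⟨i, hi⟩ := hc
    intro h0
    refine hi ((hq _).1 ?_)
    have := congrArg (fun g => g (Pi.single i 1)) h0
    simpa [f] using this
  obtain ⟨s', t', hst⟩ := exists_span_pair_eq_of_le_ker f hf T (by
    rintro _ ⟨v, hv, rfl⟩
    rw [LinearMap.mem_ker, hfapp, (hS v).1 hv, map_zero])
  obtain ⟨s, hs, rfl⟩ : s' ∈ T := hst ▸ Submodule.subset_span (by simp)
  obtain ⟨t, ht, rfl⟩ : t' ∈ T := hst ▸ Submodule.subset_span (by simp)
  have hle : S ≤ Submodule.span R {s, t} := by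
    refine Submodule.le_of_le_smul_of_le_jacobson_bot (I := maximalIdeal R)
      (IsNoetherian.noetherian S) (maximalIdeal_le_jacobson _) (fun v hv => ?_)
    have hvT : q ∘ v ∈ T := ⟨v, hv, rfl⟩
    rw [← hst, Submodule.mem_span_pair] at hvT
    obtain ⟨α, β, hαβ⟩ := hvT
    obtain ⟨α, rfl⟩ := Ideal.Quotient.mk_surjective α
    obtain ⟨β, rfl⟩ := Ideal.Quotient.mk_surjective β
    have hdvd : ∀ i, x ∣ (v - (α • s + β • t)) i := by
      intro i
      rw [← hq]
      have := congrFun hαβ i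
      simp only [Pi.add_apply, Pi.smul_apply, Function.comp_apply, smul_eq_mul] at this
      simp only [Pi.sub_apply, Pi.add_apply, Pi.smul_apply, smul_eq_mul, map_sub, map_add,
        map_mul, ← this]
      exact sub_self _
    choose w hw using hdvd
    have hvw : v - (α • s + β • t) = x • w := funext hw
    have hmem : v - (α • s + β • t) ∈ S :=
      S.sub_mem hv (S.add_mem (S.smul_mem _ hs) (S.smul_mem _ ht))
    have hwS : w ∈ S := by
      rw [hvw, hS, smul_dotProduct, smul_eq_mul, mul_eq_zero] at hmem
      exact (hS w).2 (hmem.resolve_left hx0)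
    rw [← sub_add_cancel v (α • s + β • t), add_comm, hvw]
    exact Submodule.add_mem_sup (Submodule.mem_span_pair.2 ⟨α, β, rfl⟩)
      (Submodule.smul_mem_smul hx hwS)
  refine ⟨s, t, (hS s).1 hs, (hS t).1 ht, fun v hv => ?_⟩
  obtain ⟨α, β, h⟩ := Submodule.mem_span_pair.1 (hle ((hS v).2 hv))
  exact ⟨α, β, h.symm⟩

open RingTheory.Sequence in
/-- In a regular local ring of dimension two, `(a, b) : e` is generated by two elements when
`a, b` is a regular sequence: its elements are the last coordinates of the syzygies
of `a, b, e`. -/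
theorem IsRegularLocalRing.exists_colon_singleton_eq_span_pair {R : Type*} [CommRing R]
    [IsRegularLocalRing R] (hdim : ringKrullDim R = 2) {a b : R}
    (h : IsWeaklyRegular R [a, b]) (e : R) :
    ∃ c d, (Ideal.span {a, b}).colon {e} = Ideal.span {c, d} := by
  obtain ⟨_, x, hx, hx0, _, _⟩ := exists_isPrincipalIdealRing_quotient hdim
  obtain ⟨ha0, hdvd⟩ := isWeaklyRegular_pair_iff.1 h
  have hmem : ∀ z, z ∈ (Ideal.span {a, b}).colon {e} ↔ ∃ α β, ![α, β, z] ⬝ᵥ ![a, b, e] = 0 := by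
    intro z
    rw [Submodule.mem_colon_singleton, smul_eq_mul, Ideal.mem_span_pair]
    simp only [dotProduct, Fin.sum_univ_three]
    constructor
    · rintro ⟨α, β, hz⟩
      exact ⟨-α, -β, by simp; linear_combination -hz⟩
    · rintro ⟨α, β, hz⟩
      simp at hz
      exact ⟨-α, -β, by linear_combination -hz⟩
  -- a common factor `x` of `a` and `b` would be a unit
  have hxab : ∃ i, ¬ x ∣ ![a, b, e] i := by
    by_contra! hall
    obtain ⟨a', ha'⟩ : x ∣ a := hall 0
    obtain ⟨b', hb'⟩ : x ∣ b := hall 1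
    obtain ⟨t, ht⟩ := hdvd a' b' (by rw [ha', hb']; ring)
    refine hx (isUnit_iff_exists_inv.2 ⟨t, ?_⟩)
    refine mul_left_cancel₀ ha0 ?_
    linear_combination -ha' - x * ht
  obtain ⟨s, t, hs, ht, hst⟩ := exists_span_pair_eq_ker hx hx0 ![a, b, e] hxab
  have hlast : ∀ v : Fin 3 → R, v ⬝ᵥ ![a, b, e] = 0 → v 2 ∈ (Ideal.span {a, b}).colon {e} := by
    intro v hv
    refine (hmem _).2 ⟨v 0, v 1, ?_⟩
    rwa [show ![v 0, v 1, v 2] = v by ext i; fin_cases i <;> rfl]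
  refine ⟨s 2, t 2, le_antisymm (fun z hz => ?_) ?_⟩
  · obtain ⟨α, β, hz⟩ := (hmem z).1 hz
    obtain ⟨γ, δ, h⟩ := hst _ hz
    exact Ideal.mem_span_pair.2 ⟨γ, δ, (congrFun h 2).symm⟩
  · rw [Ideal.span_le]
    rintro z (rfl | rfl)
    exacts [hlast s hs, hlast t ht]

end ColonSingleton

/-! ### The Hilbert–Burch theorem and the link of the ideal -/

section Link

open Matrix IsLocalRing RingTheory.Sequence

variable {R : Type*} [CommRing R]

theorem det_eq_dotProduct_signedColMinor {m : ℕ} (A : Matrix (Fin (m + 1)) (Fin (m + 1)) R) :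
    A.det = ((-1 : R) ^ m • A (Fin.last m)) ⬝ᵥ signedColMinor (A.submatrix Fin.castSucc id) := by
  rw [det_succ_row A (Fin.last m)]
  refine Finset.sum_congr rfl fun j _ => ?_
  simp only [signedColMinor, colMinor, submatrix_submatrix, Fin.succAbove_last, Fin.val_last,
    Pi.smul_apply, smul_eq_mul, Function.comp_id, Function.id_comp]
  ring

theorem rowMinor_last {k : ℕ} (φ : Matrix (Fin (k + 2)) (Fin (k + 1)) R) :
    rowMinor φ (Fin.last (k + 1)) = ((-1 : R) ^ k • φ (Fin.last k).castSucc) ⬝ᵥ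
      signedColMinor (deleteLastTwoRows φ) := by
  rw [rowMinor, det_eq_dotProduct_signedColMinor]
  congr 2
  · ext j
    simp
  · ext i j
    simp only [submatrix_apply, deleteLastTwoRows, Fin.succAbove_last, id]
    rfl

theorem rowMinor_castSucc_last {k : ℕ} (φ : Matrix (Fin (k + 2)) (Fin (k + 1)) R) :
    rowMinor φ (Fin.last k).castSucc = ((-1 : R) ^ k • φ (Fin.last (k + 1))) ⬝ᵥ
      signedColMinor (deleteLastTwoRows φ) := by
  rw [rowMinor, det_eq_dotProduct_signedColMinor]
  congr 2
  · ext j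
    simp only [submatrix_apply, Fin.succAbove_castSucc_self, Fin.succ_last, id]
  · ext i j
    simp only [submatrix_apply, deleteLastTwoRows, id]
    rw [Fin.succAbove_of_castSucc_lt _ _ (by simp)]
    rfl

theorem rowMinor_eq_dotProduct {m : ℕ} (φ : Matrix (Fin (m + 1)) (Fin m) R) (i : Fin (m + 1)) :
    rowMinor φ i = Pi.single i ((-1) ^ (i : ℕ)) ⬝ᵥ signedColMinor φᵀ := by
  rw [single_dotProduct, signedColMinor, ← mul_assoc, ← mul_pow, neg_one_mul, neg_neg, one_pow,
    one_mul, rowMinor, colMinor, ← det_transpose]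
  rfl

theorem Ideal.height_radical (I : Ideal R) : I.radical.height = I.height := by
  rw [Ideal.height_eq_inf_minimalPrimes, Ideal.radical_minimalPrimes,
    ← Ideal.height_eq_inf_minimalPrimes]

theorem LinearMap.coe_apply_eq_dotProduct {n : ℕ} {I : Ideal R} (π : (Fin n → R) →ₗ[R] I)
    (v : Fin n → R) : (π v : R) = v ⬝ᵥ fun i => (π (Pi.single i 1) : R) := by
  conv_lhs => rw [pi_eq_sum_univ' v]
  simp [dotProduct]

/-- The Hilbert–Burch theorem: the generators of `I` given by a free resolution are, up to a common
factor, the signed maximal minors of the matrix of the resolution. -/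
theorem IsFreeResolution.exists_eq_mul_signedColMinor [IsDomain R] {m : ℕ} {I : Ideal R}
    {φ : Matrix (Fin (m + 1)) (Fin m) R} {π : (Fin (m + 1) → R) →ₗ[R] I}
    (hres : IsFreeResolution I φ π) {i j : Fin (m + 1)}
    (h : IsWeaklyRegular R [rowMinor φ i, rowMinor φ j]) :
    ∃ u, ∀ l, (π (Pi.single l 1) : R) = u * signedColMinor φᵀ l := by
  have hker : φᵀ *ᵥ (fun l => (π (Pi.single l 1) : R)) = 0 := by
    ext l
    have h0 : π (φ.mulVecLin (Pi.single l 1)) = 0 := (hres.exact _).2 ⟨_, rfl⟩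
    have h1 := LinearMap.coe_apply_eq_dotProduct π (φ.mulVecLin (Pi.single l 1))
    rw [h0, mulVecLin_apply, mulVec_single_one] at h1
    exact h1.symm
  obtain ⟨u, hu⟩ := exists_eq_smul_signedColMinor h (rowMinor_eq_dotProduct φ i)
    (rowMinor_eq_dotProduct φ j) hker
  exact ⟨u, congrFun hu⟩

/-- In dimension two, an ideal whose radical is the maximal ideal is not contained in a proper
principal ideal, by Krull's principal ideal theorem. -/
theorem isUnit_of_le_span_singleton [IsLocalRing R] [IsNoetherianRing R]
    (hdim : ringKrullDim R = 2) {I : Ideal R} (hIm : I.radical = maximalIdeal R) {u : R}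
    (hu : I ≤ Ideal.span {u}) : IsUnit u := by
  by_contra hcon
  have h1 := Ideal.height_span_singleton_le_one hcon
  have hle : maximalIdeal R ≤ (Ideal.span {u}).radical := hIm ▸ Ideal.radical_mono hu
  have h2 := maximalIdeal_height_eq_ringKrullDim (R := R)
  rw [hdim] at h2
  have h3 : (maximalIdeal R).height = 2 := WithBot.coe_injective h2
  have h4 := Ideal.height_mono hle
  rw [Ideal.height_radical, h3] at h4
  exact absurd (h4.trans h1) (by decide)

/-- The link `J : I` is generated by the maximal minors of `φ'`: multiplication by `x` maps `I`
to `J` exactly when `x` annihilates the cokernel of `φ'`, which is `I / J`. -/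
theorem IsFreeResolution.colon_eq_span_range_colMinor [IsDomain R] {k : ℕ} {I : Ideal R}
    {φ : Matrix (Fin (k + 2)) (Fin (k + 1)) R} {π : (Fin (k + 2) → R) →ₗ[R] I}
    (hres : IsFreeResolution I φ π) {a b : R} (ha : a = rowMinor φ (Fin.last k).castSucc)
    (hb : b = rowMinor φ (Fin.last (k + 1))) (h : IsWeaklyRegular R [a, b]) {u : R}
    (hu : IsUnit u) (hπ : ∀ l, (π (Pi.single l 1) : R) = u * signedColMinor φᵀ l) :
    (Ideal.span {a, b}).colon (I : Set R) =
      Ideal.span (Set.range (colMinor (deleteLastTwoRows φ))) := by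
  have hφ' : ∀ w (i : Fin k), (deleteLastTwoRows φ *ᵥ w) i = (φ *ᵥ w) i.castSucc.castSucc :=
    fun w i => rfl
  -- the images of the last two basis vectors are unit multiples of `a` and `b`
  have hunit : ∀ l, ∃ v, IsUnit v ∧ (π (Pi.single l 1) : R) = v * rowMinor φ l := by
    intro l
    refine ⟨u * (-1) ^ (l : ℕ), hu.mul ((isUnit_one.neg).pow _), ?_⟩
    rw [hπ, rowMinor_eq_dotProduct, single_dotProduct]
    linear_combination (- u * signedColMinor φᵀ l) *
      (by rw [← mul_pow]; simp : (-1 : R) ^ (l : ℕ) * (-1) ^ (l : ℕ) = 1)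
  obtain ⟨va, hva, hpa⟩ := hunit (Fin.last k).castSucc
  obtain ⟨vb, hvb, hpb⟩ := hunit (Fin.last (k + 1))
  rw [← ha] at hpa
  rw [← hb] at hpb
  have hsplit : ∀ v, (π v : R) = ∑ i : Fin k, v i.castSucc.castSucc *
      (π (Pi.single i.castSucc.castSucc 1) : R) + v (Fin.last k).castSucc * (va * a) +
        v (Fin.last (k + 1)) * (vb * b) := by
    intro v
    rw [LinearMap.coe_apply_eq_dotProduct, dotProduct, Fin.sum_univ_castSucc,
      Fin.sum_univ_castSucc, hpa, hpb]
  apply le_antisymm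
  · intro x hx
    rw [Submodule.mem_colon] at hx
    have hcol : ∀ i : Fin k, ∃ w, deleteLastTwoRows φ *ᵥ w = x • Pi.single i 1 := by
      intro i
      obtain ⟨α, β, hαβ⟩ := Ideal.mem_span_pair.1
        (hx _ (π (Pi.single i.castSucc.castSucc 1)).2)
      obtain ⟨va', hva'⟩ := hva.exists_left_inv
      obtain ⟨vb', hvb'⟩ := hvb.exists_left_inv
      have hmem : π (x • Pi.single i.castSucc.castSucc 1 -
          (α * va') • Pi.single (Fin.last k).castSucc 1 -
            (β * vb') • Pi.single (Fin.last (k + 1)) 1) = 0 := by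
        apply Subtype.ext
        simp only [map_sub, map_smul, Submodule.coe_sub, Submodule.coe_smul, smul_eq_mul,
          Submodule.coe_zero, hpa, hpb]
        rw [smul_eq_mul] at hαβ
        linear_combination -hαβ - α * a * hva' - β * b * hvb'
      obtain ⟨w, hw⟩ := (hres.exact _).1 hmem
      refine ⟨w, ?_⟩
      ext j
      rw [hφ', ← mulVecLin_apply, hw]
      have h1 : j.castSucc.castSucc ≠ (Fin.last k).castSucc := fun hcon =>
        (Fin.castSucc_lt_last j).ne (Fin.castSucc_injective _ hcon)
      have h2 : j.castSucc.castSucc ≠ Fin.last (k + 1) := (Fin.castSucc_lt_last _).ne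
      simp [Pi.single_apply, h1, h2]
    choose w hw using hcol
    rw [mem_span_range_colMinor_iff]
    refine exists_eq_dotProduct_signedColMinor h (ha.trans (rowMinor_castSucc_last φ))
      (hb.trans (rowMinor_last φ)) (B := (Matrix.of w)ᵀ) ?_
    ext i j
    have := congrFun (hw j) i
    rw [Matrix.smul_apply, one_apply]
    rw [Pi.smul_apply, Pi.single_apply] at this
    exact this
  · intro x hx
    obtain ⟨r, rfl⟩ := mem_span_range_colMinor_iff.1 hx
    rw [Submodule.mem_colon]
    intro y hy
    obtain ⟨v, hv⟩ := hres.surjective ⟨y, hy⟩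
    obtain ⟨w, hw⟩ := exists_mulVec_eq_smul (deleteLastTwoRows φ) r
      (fun i => v i.castSucc.castSucc)
    set x := r ⬝ᵥ signedColMinor (deleteLastTwoRows φ)
    have hxy : x • y = (π (x • v - φ.mulVecLin w) : R) := by
      rw [map_sub, (hres.exact (φ.mulVecLin w)).2 ⟨w, rfl⟩, sub_zero, map_smul, hv]
      rfl
    rw [hxy, hsplit, Finset.sum_eq_zero, zero_add]
    · refine add_mem (Ideal.mul_mem_left _ _ (Ideal.mul_mem_left _ _ ?_))
        (Ideal.mul_mem_left _ _ (Ideal.mul_mem_left _ _ ?_)) <;>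
      exact Ideal.subset_span (by simp)
    · intro i _
      have := congrFun hw i
      rw [hφ'] at this
      rw [Pi.sub_apply, mulVecLin_apply, this]
      simp

end Link

/-! ### Generators of the link modulo the complete intersection -/

section Generators

open Matrix IsLocalRing RingTheory.Sequence

variable {R : Type*} [CommRing R]

/-- In a regular local ring of dimension two, `(a, b) : e` is a complete intersection of
codimension two for a regular sequence `a, b`, when it is primary to the maximal ideal: it has two
generators, and these form a regular sequence since they generate an ideal containing `a, b`. -/
theorem IsRegularLocalRing.isCompleteIntersectionOfCodim_colon_singleton [IsRegularLocalRing R]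
    (hdim : ringKrullDim R = 2) {a b : R} (h : IsWeaklyRegular R [a, b]) {e : R}
    (he : e ∉ Ideal.span {a, b})
    (hrad : maximalIdeal R ≤ ((Ideal.span {a, b}).colon {e}).radical) :
    IsCompleteIntersectionOfCodim ((Ideal.span {a, b}).colon {e}) 2 := by
  obtain ⟨_, -⟩ := exists_isPrincipalIdealRing_quotient hdim
  have htop : (Ideal.span {a, b}).colon {e} ≠ ⊤ := by
    rw [Ideal.ne_top_iff_one, Submodule.mem_colon_singleton, one_smul]
    exact he
  have hradm : ((Ideal.span {a, b}).colon {e}).radical = maximalIdeal R :=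
    le_antisymm (le_maximalIdeal (by rwa [Ne, Ideal.radical_eq_top])) hrad
  obtain ⟨c, d, hcd⟩ := exists_colon_singleton_eq_span_pair hdim h e
  have hle : Ideal.span {a, b} ≤ Ideal.span {c, d} := hcd ▸ Ideal.le_colon
  rw [hcd] at hradm htop ⊢
  have hc : c ≠ 0 := by
    -- otherwise the ideal would be principal
    rintro rfl
    have hunit := isUnit_of_le_span_singleton hdim hradm (Ideal.span_insert_zero).le
    rw [Ideal.span_insert_zero, Ne, Ideal.span_singleton_eq_top] at htop
    exact htop hunit
  have hreg := isWeaklyRegular_pair_of_mem_span h hc (hle (Ideal.subset_span (by simp)))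
    (hle (Ideal.subset_span (by simp)))
  refine ⟨?_, [c, d], rfl, ?_, ?_⟩
  · rw [← Ideal.height_radical, hradm]
    have h2 := maximalIdeal_height_eq_ringKrullDim (R := R)
    rw [hdim] at h2
    exact WithBot.coe_injective h2
  · refine (isRegular_iff_isWeaklyRegular_of_subset_maximalIdeal fun r hr => ?_).2 hreg
    refine le_maximalIdeal htop (Ideal.subset_span ?_)
    simpa using hr
  · rw [Ideal.ofList_cons, Ideal.ofList_singleton, Ideal.span_insert]

/-- If the syzygies of `δ` have coefficients in the maximal ideal, then the ideal generated by
the `m + 1` elements `δ` is not generated by `m` elements. -/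
theorem span_range_ne_of_syzygies_mem [IsLocalRing R] {m : ℕ} {δ : Fin (m + 1) → R}
    (hδ : ∀ c : Fin (m + 1) → R, c ⬝ᵥ δ = 0 → ∀ j, c j ∈ maximalIdeal R) (e : Fin m → R) :
    Ideal.span (Set.range e) ≠ Ideal.span (Set.range δ) := by
  intro heq
  have h1 : ∀ i, ∃ c : Fin m → R, c ⬝ᵥ e = δ i := fun i =>
    (Ideal.mem_span_range_iff_exists_fun).1 (heq ▸ Ideal.subset_span ⟨i, rfl⟩)
  have h2 : ∀ l, ∃ c : Fin (m + 1) → R, c ⬝ᵥ δ = e l := fun l =>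
    (Ideal.mem_span_range_iff_exists_fun).1 (heq ▸ Ideal.subset_span ⟨l, rfl⟩)
  choose A hA using h1
  choose B hB using h2
  have hAe : Matrix.of A *ᵥ e = δ := funext hA
  have hBδ : Matrix.of B *ᵥ δ = e := funext hB
  -- modulo the maximal ideal, the identity matrix factors through a space of dimension `m`
  have hsyz : ∀ i j, (1 - Matrix.of A * Matrix.of B :
      Matrix (Fin (m + 1)) (Fin (m + 1)) R) i j ∈ maximalIdeal R := by
    intro i
    refine hδ _ ?_
    have : (1 - Matrix.of A * Matrix.of B) *ᵥ δ = 0 := by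
      rw [sub_mulVec, one_mulVec, ← mulVec_mulVec, hBδ, hAe, sub_self]
    exact congrFun this i
  have hone : (Matrix.of A).map (residue R) * (Matrix.of B).map (residue R) = 1 := by
    rw [← Matrix.map_mul]
    ext i j
    have := (residue_eq_zero_iff _).2 (hsyz i j)
    rw [Matrix.sub_apply, map_sub, sub_eq_zero] at this
    rw [Matrix.map_apply, ← this, one_apply, one_apply]
    split_ifs <;> simp
  have hrank := rank_mul_le_left ((Matrix.of A).map (residue R)) ((Matrix.of B).map (residue R))
  rw [hone, rank_one, Fintype.card_fin] at hrank
  have := hrank.trans (rank_le_width _)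
  omega

/-- Nakayama's lemma for generators of `K / J` with `J ⊆ 𝔪 K`. -/
theorem Ideal.eq_span_of_le_sup [IsLocalRing R] [IsNoetherianRing R] {J K : Ideal R} {s : Set R}
    (hs : s ⊆ K) (hJ : J ≤ maximalIdeal R • K) (hK : K ≤ Ideal.span s ⊔ J) :
    K = Ideal.span s := by
  refine le_antisymm ?_ (Ideal.span_le.2 hs)
  exact Submodule.le_of_le_smul_of_le_jacobson_bot (IsNoetherian.noetherian K)
    (maximalIdeal_le_jacobson _) (hK.trans (sup_le_sup_left hJ _))

theorem dotProduct_signedColMinor_mem_smul [IsLocalRing R] {m : ℕ}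
    {M : Matrix (Fin m) (Fin (m + 1)) R} {r : Fin (m + 1) → R}
    (hr : ∀ j, r j ∈ maximalIdeal R) :
    r ⬝ᵥ signedColMinor M ∈ maximalIdeal R • Ideal.span (Set.range (colMinor M)) :=
  Submodule.sum_mem _ fun j _ => Submodule.smul_mem_smul (hr j)
    (Ideal.mul_mem_left _ _ (Ideal.subset_span ⟨j, rfl⟩))

theorem span_range_mk_eq_map_iff {ι : Type*} {J K : Ideal R} (hJK : J ≤ K) (e : ι → R) :
    Ideal.span (Set.range fun i => Ideal.Quotient.mk J (e i)) = K.map (Ideal.Quotient.mk J) ↔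
      Ideal.span (Set.range e) ⊔ J = K := by
  have hmap : Ideal.span (Set.range fun i => Ideal.Quotient.mk J (e i)) =
      (Ideal.span (Set.range e)).map (Ideal.Quotient.mk J) := by
    rw [Ideal.map_span, ← Set.range_comp]
    rfl
  have hcomap : ∀ L : Ideal R, (L.map (Ideal.Quotient.mk J)).comap (Ideal.Quotient.mk J) =
      L ⊔ J := fun L => by
    rw [Ideal.comap_map_of_surjective' _ Ideal.Quotient.mk_surjective, Ideal.mk_ker]
  rw [hmap, ← (Ideal.comap_injective_of_surjective _
    (Ideal.Quotient.mk_surjective (I := J))).eq_iff, hcomap, hcomap, sup_eq_left.2 hJK]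

end Generators

theorem mainTheorem8 {R : Type*} [CommRing R] [IsRegularLocalRing R]
    (hdim : ringKrullDim R = 2)
    (I : Ideal R) (hI : I.IsPrimary) (hIm : I.radical = IsLocalRing.maximalIdeal R)
    -- the resolution has the form `0 → R^{n-1} → R^n → I → 0` with `n = k + 2`
    (k : ℕ) (φ : Matrix (Fin (k + 2)) (Fin (k + 1)) R)
    (π : (Fin (k + 2) → R) →ₗ[R] I) (hres : IsFreeResolution I φ π)
    (a b : R) (ha : a = rowMinor φ (Fin.last k).castSucc) (hb : b = rowMinor φ (Fin.last (k + 1)))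
    (hreg : RingTheory.Sequence.IsRegular R [a, b])
    (J : Ideal R) (hJ : J = Ideal.span {a, b}) :
    -- `J : I = I_{n-2}(φ') = (δ_1, …, δ_{n-1})`, with `δ_j` the maximal minors of `φ'`
    (J.colon (I : Set R) = determinantalIdeal k (deleteLastTwoRows φ) ∧
      determinantalIdeal k (deleteLastTwoRows φ) =
        Ideal.span (Set.range (colMinor (deleteLastTwoRows φ)))) ∧
    -- for generators `e_1, …, e_{n-1}` of `E = (J : I) / J` (for instance the `δ_j`), each
    -- `J : e_i` with `e_i ≠ 0` in `E` is a complete intersection of codimension two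
    (∀ e : Fin (k + 1) → R,
      Ideal.span (Set.range fun i => Ideal.Quotient.mk J (e i)) = colonModulo J I →
      ∀ i, Ideal.Quotient.mk J (e i) ≠ 0 →
        IsCompleteIntersectionOfCodim (J.colon {e i}) 2) ∧
    -- if the resolution is minimal, then any such generators `e_i` are nonzero in `E` and
    -- generate the ideal `J : I`
    ((∀ p q, φ p q ∈ IsLocalRing.maximalIdeal R) →
      ∀ e : Fin (k + 1) → R,
        Ideal.span (Set.range fun i => Ideal.Quotient.mk J (e i)) = colonModulo J I →
        (∀ i, Ideal.Quotient.mk J (e i) ≠ 0) ∧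
          J.colon (I : Set R) = Ideal.span (Set.range e)) := by
  obtain ⟨_, -⟩ := IsRegularLocalRing.exists_isPrincipalIdealRing_quotient hdim
  have hw : RingTheory.Sequence.IsWeaklyRegular R [a, b] := hreg.toIsWeaklyRegular
  obtain ⟨u, hπ⟩ := hres.exists_eq_mul_signedColMinor (i := (Fin.last k).castSucc)
    (j := Fin.last (k + 1)) (by rwa [← ha, ← hb])
  have hu : IsUnit u := by
    refine isUnit_of_le_span_singleton hdim hIm fun y hy => ?_
    obtain ⟨v, hv⟩ := hres.surjective ⟨y, hy⟩
    have hy' : y = (π v : R) := by rw [hv]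
    rw [hy', LinearMap.coe_apply_eq_dotProduct]
    refine Submodule.sum_mem _ fun l _ => Ideal.mul_mem_left _ _ ?_
    beta_reduce
    rw [hπ]
    exact Ideal.mul_mem_right _ _ (Ideal.mem_span_singleton_self u)
  subst hJ
  have hcolon := hres.colon_eq_span_range_colMinor ha hb hw hu hπ
  have hJle : Ideal.span {a, b} ≤ (Ideal.span {a, b}).colon (I : Set R) := Ideal.le_colon
  have hsup : ∀ e : Fin (k + 1) → R,
      Ideal.span (Set.range fun i => Ideal.Quotient.mk (Ideal.span {a, b}) (e i)) =
        colonModulo (Ideal.span {a, b}) I →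
      Ideal.span (Set.range e) ⊔ Ideal.span {a, b} = (Ideal.span {a, b}).colon (I : Set R) :=
    fun e he => (span_range_mk_eq_map_iff hJle e).1 he
  refine ⟨⟨?_, determinantalIdeal_eq_span_range_colMinor _⟩, fun e he i hi => ?_,
    fun hmin e he => ?_⟩
  · rw [hcolon, determinantalIdeal_eq_span_range_colMinor]
  · rw [Ne, Ideal.Quotient.eq_zero_iff_mem] at hi
    refine IsRegularLocalRing.isCompleteIntersectionOfCodim_colon_singleton hdim hw hi ?_
    rw [← hIm]
    refine Ideal.radical_mono fun y hy => ?_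
    have hei : e i ∈ (Ideal.span {a, b}).colon (I : Set R) := by
      rw [← hsup e he]
      exact Ideal.mem_sup_left (Ideal.subset_span ⟨i, rfl⟩)
    rw [Submodule.mem_colon_singleton, smul_eq_mul, mul_comm]
    exact Submodule.mem_colon.1 hei y hy
  · have hJm : Ideal.span {a, b} ≤
        IsLocalRing.maximalIdeal R • (Ideal.span {a, b}).colon (I : Set R) := by
      rw [hcolon, Ideal.span_le]
      rintro z (rfl | rfl)
      · rw [ha, rowMinor_castSucc_last]
        exact dotProduct_signedColMinor_mem_smul fun j =>
          Ideal.mul_mem_left _ _ (hmin _ j)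
      · rw [hb, rowMinor_last]
        exact dotProduct_signedColMinor_mem_smul fun j =>
          Ideal.mul_mem_left _ _ (hmin _ j)
    have hmem : ∀ i, e i ∈ (Ideal.span {a, b}).colon (I : Set R) := fun i => by
      rw [← hsup e he]
      exact Ideal.mem_sup_left (Ideal.subset_span ⟨i, rfl⟩)
    refine ⟨fun i hi => ?_, Ideal.eq_span_of_le_sup (Set.range_subset_iff.2 hmem) hJm
      (hsup e he).ge⟩
    rw [Ideal.Quotient.eq_zero_iff_mem] at hi
    -- the `k` elements other than `e i` would generate `J : I`, which needs `k + 1` generators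
    have hfew := Ideal.eq_span_of_le_sup (s := Set.range (e ∘ i.succAbove))
      (Set.range_subset_iff.2 fun l => hmem _) hJm (by
        refine (hsup e he).ge.trans (sup_le (Ideal.span_le.2 ?_) le_sup_right)
        rintro _ ⟨j, rfl⟩
        rcases eq_or_ne j i with rfl | hj
        · exact Ideal.mem_sup_right hi
        · obtain ⟨l, rfl⟩ := Fin.exists_succAbove_eq hj
          exact Ideal.mem_sup_left (Ideal.subset_span ⟨l, rfl⟩))
    have hδ : Ideal.span (Set.range (signedColMinor (deleteLastTwoRows φ))) =
        Ideal.span (Set.range (colMinor (deleteLastTwoRows φ))) := by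
      ext x
      rw [mem_span_range_colMinor_iff, Ideal.mem_span_range_iff_exists_fun]
      exact exists_congr fun r => eq_comm
    refine span_range_ne_of_syzygies_mem (fun c hc j => ?_) (e ∘ i.succAbove)
      (hfew.symm.trans (hcolon.trans hδ.symm))
    obtain ⟨s, rfl⟩ := exists_eq_vecMul_of_dotProduct_eq_zero hw
      (ha.trans (rowMinor_castSucc_last φ)) (hb.trans (rowMinor_last φ)) hc
    rw [Matrix.vecMul, dotProduct]
    exact Submodule.sum_mem _ fun l _ => Ideal.mul_mem_left _ _ (hmin _ j)
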